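/- Let $m\ge 3$ be an integer and let $\alpha,\beta>0$ with $\alpha+\beta=1$. Let $\mathbb{T}_m$ be the directed tree whose vertices are the finite (possibly empty) sequences with entries in $\{0,\dots,m-1\}$; the set $S(x)$ of successors of $x=(a_1,\dots,a_k)$ consists of the $m$ vertices $(a_1,\dots,a_k,a)$, $0\le a\le m-1$. A branch is an infinite sequence $\pi=(a_1,a_2,\dots)$ of such digits; it passes through the vertices $x_k=(a_1,\dots,a_k)$, and it determines the point $\psi(\pi)=\sum_{k\ge1}a_km^{-k}\in[0,1]$. Write $F(\pi)=F(\psi(\pi))$ for $F:[0,1]\to\mathbb{R}$. A function $u:\mathbb{T}_m\to\mathbb{R}$ is $p$-harmonious if for all $x\in\mathbb{T}_m$ $$u(x)=\frac{\alpha}{2}\Big\{\max_{y\in S(x)}u(y)+\min_{y\in S(x)}u(y)\Big\}+\frac{\beta}{m}\sum_{y\in S(x)}u(y).$$ For continuous $F:[0,1]\to\mathbb{R}$, a solution of the Dirichlet problem with boundary data $F$ is a $p$-harmonious $u$ such that $\lim_{k\to\infty}u(x_k)=F(\pi)$ for every branch $\pi$. In the Tug-of-War game with noise and payoff $F$, a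 strategy of a player assigns to every partial history $(x_0,\dots,x_k)$ a vertex in $S(x_k)$. Given strategies $S_I,S_{II}$ of Players I and II and an initial vertex $x_0$, the play $(x_0,x_1,\dots)$ is the random sequence in which, given $(x_0,\dots,x_k)$, the next position $x_{k+1}$ is the vertex chosen by $S_I$ with probability $\alpha/2$, the vertex chosen by $S_{II}$ with probability $\alpha/2$, and a uniformly distributed element of $S(x_k)$ with probability $\beta$. Let $\mathbb{P}^{x_0}_{S_I,S_{II}}$ be the law on $[0,1]$ of $\psi(\pi)$, where $\pi$ is the branch followed by the play (it starts with the entries of $x_0$), and let $\mathbb{E}^{x_0}_{S_I,S_{II}}[F]=\int_0^1F\,d\mathbb{P}^{x_0}_{S_I,S_{II}}$. The values for the two players are $$u_I(x_0)=\sup_{S_I}\inf_{S_{II}}\mathbb{E}^{x_0}_{S_I,S_{II}}[F],\qquad u_{II}(x_0)=\inf_{S_{II}}\sup_{S_I}\mathbb{E}^{x_0}_{S_I,S_{II}}[F].$$ **Theorem.** For every continuous $F:[0,1]\to\mathbb{R}$ the Dirichlet problem with boundary data $F$ has exactly one bounded solution $u$. Moreover, the game with payoff $F$ has a value, and it coincides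 with $u$: $u_I(x_0)=u_{II}(x_0)=u(x_0)$ for every $x_0\in\mathbb{T}_m$. -/

import Mathlib

open MeasureTheory ProbabilityTheory Filter Topology

/-- The vertices of the directed tree with regular `m`-branching: finite sequences of digits in
`{0, …, m - 1}`; the root is the empty sequence. -/
abbrev TreeVertex (m : ℕ) : Type := List (Fin m)

instance TreeVertex.instMeasurableSpace (m : ℕ) : MeasurableSpace (TreeVertex m) := ⊤

instance TreeVertex.instDiscreteMeasurableSpace (m : ℕ) :
    DiscreteMeasurableSpace (TreeVertex m) := ⟨fun _ => trivial⟩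

/-- The successor of `x` obtained by adding the further coordinate `a`. -/
def TreeVertex.child {m : ℕ} (x : TreeVertex m) (a : Fin m) : TreeVertex m := x ++ [a]

/-- The set of successors of `x`. -/
def TreeVertex.successors {m : ℕ} (x : TreeVertex m) : Set (TreeVertex m) :=
  Set.range x.child

/-- The number of branches is at least three, and the two weights are positive with sum one. -/
structure IsGameParameters (m : ℕ) (α β : ℝ) : Prop where
  two_lt : 2 < m
  alpha_pos : 0 < α
  beta_pos : 0 < β
  add_eq_one : α + β = 1

/-- The right-hand side of the game `p`-Laplace equation. For `m > 0` the supremum and infimum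
over the finitely many successors are a maximum and a minimum. -/
noncomputable def gameAverage {m : ℕ} (α β : ℝ) (u : TreeVertex m → ℝ) (x : TreeVertex m) : ℝ :=
  α / 2 * ((⨆ a : Fin m, u (x.child a)) + ⨅ a : Fin m, u (x.child a))
    + β / m * ∑ a : Fin m, u (x.child a)

def IsPSubharmonious {m : ℕ} (α β : ℝ) (u : TreeVertex m → ℝ) : Prop :=
  ∀ x, u x ≤ gameAverage α β u x

def IsPSuperharmonious {m : ℕ} (α β : ℝ) (u : TreeVertex m → ℝ) : Prop :=
  ∀ x, gameAverage α β u x ≤ u x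

def IsPHarmonious {m : ℕ} (α β : ℝ) (u : TreeVertex m → ℝ) : Prop :=
  IsPSubharmonious α β u ∧ IsPSuperharmonious α β u

/-- The branches of the tree, that is, its boundary: infinite sequences of digits. -/
abbrev TreeBranch (m : ℕ) : Type := ℕ → Fin m

/-- The vertex of level `k` on a branch: its first `k` digits. -/
def TreeBranch.vertex {m : ℕ} (π : TreeBranch m) (k : ℕ) : TreeVertex m :=
  List.ofFn fun i : Fin k => π i

/-- The point `ψ(π) = ∑_{k ≥ 1} a_k / m ^ k` of `[0,1]` given by a branch `π = (a₁, a₂, …)`. -/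
noncomputable def TreeBranch.point {m : ℕ} (π : TreeBranch m) : unitInterval :=
  ⟨Real.ofDigits π, Real.ofDigits_nonneg π, Real.ofDigits_le_one π⟩

/-- `u` solves the Dirichlet problem with boundary data `F`. -/
def IsDirichletSolution {m : ℕ} (α β : ℝ) (F : unitInterval → ℝ) (u : TreeVertex m → ℝ) : Prop :=
  IsPHarmonious α β u ∧
    ∀ π : TreeBranch m, Tendsto (fun k => u (π.vertex k)) atTop (𝓝 (F π.point))

def IsBoundedFunction {m : ℕ} (u : TreeVertex m → ℝ) : Prop :=
  ∃ C : ℝ, ∀ x, |u x| ≤ C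

/-- Partial histories `(x₀, …, x_k)` of the game. -/
abbrev GameHistory (m k : ℕ) : Type := Finset.Iic k → TreeVertex m

/-- The current position `x_k` after the partial history `(x₀, …, x_k)`. -/
def GameHistory.last {m k : ℕ} (h : GameHistory m k) : TreeVertex m :=
  h ⟨k, Finset.mem_Iic.2 le_rfl⟩

/-- A strategy chooses a successor of the current position given the whole partial history.
All maps on histories are measurable, since the space of histories is countable and discrete. -/
structure GameStrategy (m : ℕ) where
  move : (k : ℕ) → GameHistory m k → TreeVertex m
  move_mem : ∀ k h, move k h ∈ h.last.successors

/-- The law of the next position `x_{k+1}` given the partial history `(x₀, …, x_k)`. -/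
noncomputable def stepKernel {m : ℕ} (α β : ℝ) (S T : GameStrategy m) (k : ℕ) :
    Kernel (GameHistory m k) (TreeVertex m) where
  toFun h := ENNReal.ofReal (α / 2) • Measure.dirac (S.move k h)
    + ENNReal.ofReal (α / 2) • Measure.dirac (T.move k h)
    + ENNReal.ofReal (β / m) • Measure.count.restrict h.last.successors
  measurable' := Measurable.of_discrete

theorem TreeVertex.count_successors {m : ℕ} (x : TreeVertex m) :
    (Measure.count : Measure (TreeVertex m)) x.successors = m := by
  have hinj : Function.Injective x.child := fun a b h => by
    simpa [TreeVertex.child] using h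
  rw [Measure.count_apply MeasurableSet.of_discrete, TreeVertex.successors,
    ← Set.image_univ, hinj.encard_image]
  simp

theorem isMarkovKernel_stepKernel {m : ℕ} {α β : ℝ} (hp : IsGameParameters m α β)
    (S T : GameStrategy m) (k : ℕ) : IsMarkovKernel (stepKernel α β S T k) := by
  refine ⟨fun h => ⟨?_⟩⟩
  have hα := hp.alpha_pos
  have hβ := hp.beta_pos
  have hm : (0 : ℝ) < m := by exact_mod_cast lt_trans Nat.two_pos hp.two_lt
  change (ENNReal.ofReal (α / 2) • Measure.dirac (S.move k h)
    + ENNReal.ofReal (α / 2) • Measure.dirac (T.move k h)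
    + ENNReal.ofReal (β / m) • Measure.count.restrict h.last.successors) Set.univ = 1
  have hcast : (m : ENNReal) = ENNReal.ofReal (m : ℝ) := (ENNReal.ofReal_natCast m).symm
  simp only [Measure.add_apply, Measure.smul_apply, measure_univ, smul_eq_mul, mul_one,
    Measure.restrict_apply_univ, TreeVertex.count_successors]
  rw [hcast, ← ENNReal.ofReal_mul (by positivity), ← ENNReal.ofReal_add (by positivity)
    (by positivity), ← ENNReal.ofReal_add (by positivity) (by positivity),
    div_mul_cancel₀ _ hm.ne', add_halves, hp.add_eq_one, ENNReal.ofReal_one]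

/-- The law of the infinite play `(x₀, x₁, …)` started at `x₀`, when Player I follows `S` and
Player II follows `T`. -/
noncomputable def playMeasure {m : ℕ} {α β : ℝ} (hp : IsGameParameters m α β)
    (S T : GameStrategy m) (x₀ : TreeVertex m) : Measure (ℕ → TreeVertex m) :=
  haveI := isMarkovKernel_stepKernel hp S T
  Kernel.traj (X := fun _ => TreeVertex m) (stepKernel α β S T) 0 (fun _ => x₀)

/-- The branch determined by a play: its digit with index `j` is that of `x_{j+1}`, a vertex of
level greater than `j`. (The default digit is never used when each position of the play is a
successor of the previous one, which is almost surely the case.) -/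
def branchOfPlay {m : ℕ} (hm : 0 < m) (ω : ℕ → TreeVertex m) : TreeBranch m :=
  fun j => (ω (j + 1)).getD j ⟨0, hm⟩

/-- The probability measure on `[0,1]` determined by the strategies and the initial state. -/
noncomputable def endMeasure {m : ℕ} {α β : ℝ} (hp : IsGameParameters m α β)
    (S T : GameStrategy m) (x₀ : TreeVertex m) : Measure unitInterval :=
  (playMeasure hp S T x₀).map fun ω =>
    (branchOfPlay (lt_trans Nat.two_pos hp.two_lt) ω).point

/-- The expected payoff of an individual game. -/
noncomputable def expectedPayoff {m : ℕ} {α β : ℝ} (hp : IsGameParameters m α β)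
    (F : unitInterval → ℝ) (S T : GameStrategy m) (x₀ : TreeVertex m) : ℝ :=
  ∫ y, F y ∂(endMeasure hp S T x₀)

/-- The value of the game for Player I. -/
noncomputable def valueI {m : ℕ} {α β : ℝ} (hp : IsGameParameters m α β)
    (F : unitInterval → ℝ) (x₀ : TreeVertex m) : ℝ :=
  ⨆ S : GameStrategy m, ⨅ T : GameStrategy m, expectedPayoff hp F S T x₀

/-- The value of the game for Player II. -/
noncomputable def valueII {m : ℕ} {α β : ℝ} (hp : IsGameParameters m α β)
    (F : unitInterval → ℝ) (x₀ : TreeVertex m) : ℝ :=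
  ⨅ T : GameStrategy m, ⨆ S : GameStrategy m, expectedPayoff hp F S T x₀

/-! ### The averaging operator: monotone, nonexpansive, odd. -/

section GameAverage

variable {m : ℕ} {α β : ℝ}

/-! The operator `gameAverage` is monotone and, since α + β = 1, commutes with adding constants.
Hence it is nonexpansive for the sup norm, and the p-harmonious functions are its fixed points.

Existence: extend F to a function f on vertices by continuing each vertex with zeros. By uniform
continuity f is almost constant below every deep vertex, so all iterates of the operator move f
little there. Nonexpansiveness carries this up the tree: the iterates converge pointwise to a fixed
point that stays close to f at deep levels (`exists_isDirichletSolution`).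

Uniqueness: the difference of two solutions does not decrease towards a suitable child. Along the
resulting path it tends to 0, so it was nonpositive at the start (`IsDirichletSolution.le`).

Value: if Player I always moves to a maximizing child for u, then u along the play has nondecreasing
expectation against any opponent. This expectation converges to the expected payoff, which is
therefore at least u(x₀). Minimizing moves give Player II the reverse bound. -/

theorem IsGameParameters.pos (hp : IsGameParameters m α β) : 0 < m :=
  lt_trans Nat.two_pos hp.two_lt

theorem gameAverage_le_add (hp : IsGameParameters m α β) {f g : TreeVertex m → ℝ} {ε : ℝ}
    {x : TreeVertex m} (h : ∀ a, f (x.child a) ≤ g (x.child a) + ε) :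
    gameAverage α β f x ≤ gameAverage α β g x + ε := by
  have : Nonempty (Fin m) := ⟨⟨0, hp.pos⟩⟩
  have hα := hp.alpha_pos
  have hβ := hp.beta_pos
  have hm : (0 : ℝ) < m := by exact_mod_cast hp.pos
  have hsup : (⨆ a : Fin m, f (x.child a)) ≤ (⨆ a : Fin m, g (x.child a)) + ε :=
    ciSup_le fun a => (h a).trans <| by
      gcongr
      exact le_ciSup (f := fun a => g (x.child a)) (Set.finite_range _).bddAbove a
  have hinf : (⨅ a : Fin m, f (x.child a)) ≤ (⨅ a : Fin m, g (x.child a)) + ε := by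
    rw [← sub_le_iff_le_add]
    refine le_ciInf fun a => ?_
    rw [sub_le_iff_le_add]
    exact (ciInf_le (f := fun a => f (x.child a)) (Set.finite_range _).bddBelow a).trans (h a)
  have hsum : ∑ a : Fin m, f (x.child a) ≤ ∑ a : Fin m, g (x.child a) + m * ε := by
    refine (Finset.sum_le_sum fun a _ => h a).trans (le_of_eq ?_)
    simp [Finset.sum_add_distrib]
  have h1 : α / 2 * ((⨆ a : Fin m, f (x.child a)) + ⨅ a : Fin m, f (x.child a)) ≤
      α / 2 * (((⨆ a : Fin m, g (x.child a)) + ε) + ((⨅ a : Fin m, g (x.child a)) + ε)) := by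
    gcongr
  have h2 : β / m * ∑ a : Fin m, f (x.child a) ≤
      β / m * (∑ a : Fin m, g (x.child a) + m * ε) := by
    gcongr
  have h3 : β / m * (m * ε) = β * ε := by field_simp
  have h4 : α * ε + β * ε = ε := by rw [← add_mul, hp.add_eq_one, one_mul]
  unfold gameAverage
  linarith

theorem abs_gameAverage_sub_le (hp : IsGameParameters m α β) {f g : TreeVertex m → ℝ} {ε : ℝ}
    {x : TreeVertex m} (h : ∀ a, |f (x.child a) - g (x.child a)| ≤ ε) :
    |gameAverage α β f x - gameAverage α β g x| ≤ ε := by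
  have h1 := gameAverage_le_add hp (f := f) (g := g) (x := x) (ε := ε)
    fun a => by linarith [(abs_le.1 (h a)).2]
  have h2 := gameAverage_le_add hp (f := g) (g := f) (x := x) (ε := ε)
    fun a => by linarith [(abs_le.1 (h a)).1]
  exact abs_le.2 ⟨by linarith, by linarith⟩

theorem gameAverage_const (hp : IsGameParameters m α β) (c : ℝ) :
    gameAverage α β (fun _ : TreeVertex m => c) = fun _ => c := by
  have : Nonempty (Fin m) := ⟨⟨0, hp.pos⟩⟩
  have hm : (m : ℝ) ≠ 0 := by exact_mod_cast hp.pos.ne'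
  ext x
  simp only [gameAverage, ciSup_const, ciInf_const, Finset.sum_const, Finset.card_univ,
    Fintype.card_fin, nsmul_eq_mul]
  have : β / m * (m * c) = β * c := by field_simp
  rw [this]
  linear_combination c * hp.add_eq_one

theorem gameAverage_neg (u : TreeVertex m → ℝ) (x : TreeVertex m) :
    gameAverage α β (fun y => -u y) x = -gameAverage α β u x := by
  have h1 : (⨆ a : Fin m, -u (x.child a)) = -⨅ a : Fin m, u (x.child a) := by
    rw [iInf, Real.sInf_def, neg_neg, iSup, ← Set.image_neg_eq_neg, ← Set.range_comp]
    rfl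
  have h2 : (⨅ a : Fin m, -u (x.child a)) = -⨆ a : Fin m, u (x.child a) := by
    rw [iInf, Real.sInf_def, iSup, ← Set.image_neg_eq_neg, ← Set.range_comp]
    simp [Function.comp_def]
  simp only [gameAverage, h1, h2, Finset.sum_neg_distrib]
  ring

/-- The k-th iterate at x sees only the descendants exactly k levels below x. -/
theorem abs_iterate_gameAverage_sub_le (hp : IsGameParameters m α β) {f g : TreeVertex m → ℝ}
    {ε : ℝ} (k : ℕ) {x : TreeVertex m}
    (h : ∀ y, x <+: y → y.length = x.length + k → |f y - g y| ≤ ε) :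
    |(gameAverage α β)^[k] f x - (gameAverage α β)^[k] g x| ≤ ε := by
  induction k generalizing x with
  | zero => exact h x List.prefix_rfl rfl
  | succ k ih =>
    rw [Function.iterate_succ_apply', Function.iterate_succ_apply']
    refine abs_gameAverage_sub_le hp fun a => ih fun y hy hl => h y ?_ ?_
    · exact (List.prefix_append x [a]).trans hy
    · simp only [hl, TreeVertex.child, List.length_append, List.length_singleton]
      omega

theorem abs_iterate_gameAverage_sub_const_le (hp : IsGameParameters m α β)
    {f : TreeVertex m → ℝ} {ε c : ℝ} (k : ℕ) {x : TreeVertex m}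
    (h : ∀ y, x <+: y → |f y - c| ≤ ε) : |(gameAverage α β)^[k] f x - c| ≤ ε := by
  have := abs_iterate_gameAverage_sub_le hp (f := f) (g := fun _ => c) k fun y hy _ => h y hy
  rwa [Function.iterate_fixed (gameAverage_const hp c)] at this

end GameAverage

/-! ### Vertices, branches and tree paths. -/

section Branches

variable {m : ℕ}

/-- The branch through `x` all of whose digits after `x` are zero. -/
def TreeVertex.toBranch (hm : 0 < m) (x : TreeVertex m) : TreeBranch m :=
  fun j => x.getD j ⟨0, hm⟩

theorem TreeVertex.toBranch_eq_of_prefix (hm : 0 < m) {x y : TreeVertex m} (h : x <+: y) {j : ℕ}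
    (hj : j < x.length) : y.toBranch hm j = x.toBranch hm j := by
  obtain ⟨t, rfl⟩ := h
  exact List.getD_append _ _ _ _ hj

theorem TreeVertex.toBranch_vertex (hm : 0 < m) (π : TreeBranch m) {j k : ℕ} (hj : j < k) :
    (π.vertex k).toBranch hm j = π j := by
  simp [TreeVertex.toBranch, TreeBranch.vertex, List.getD_eq_getElem?_getD, hj]

theorem TreeBranch.length_vertex (π : TreeBranch m) (k : ℕ) : (π.vertex k).length = k := by
  simp [TreeBranch.vertex]

theorem TreeBranch.continuous_point : Continuous (TreeBranch.point : TreeBranch m → _) :=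
  Real.continuous_ofDigits.subtype_mk _

/-- Branches with the same first N digits have points at distance at most m⁻ᴺ, and F is uniformly
continuous. -/
theorem exists_forall_abs_sub_le_of_digits_eq (hm : 1 < m) {F : unitInterval → ℝ}
    (hF : Continuous F) {ε : ℝ} (hε : 0 < ε) :
    ∃ N, ∀ π π' : TreeBranch m, (∀ j < N, π j = π' j) → |F π.point - F π'.point| ≤ ε := by
  obtain ⟨δ, hδ, h⟩ := Metric.uniformContinuous_iff.1
    (CompactSpace.uniformContinuous_of_continuous hF) ε hε
  have hm' : (1 : ℝ) < m := by exact_mod_cast hm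
  obtain ⟨N, hN⟩ := exists_pow_lt_of_lt_one hδ (inv_lt_one_of_one_lt₀ hm')
  refine ⟨N, fun π π' hπ => ?_⟩
  refine (h (a := π.point) (b := π'.point) ?_).le
  rw [Subtype.dist_eq, Real.dist_eq]
  refine (Real.abs_ofDigits_sub_ofDigits_le hπ).trans_lt ?_
  rwa [← inv_pow]

/-- The path in the tree given by `ω` moves to a successor in each step. -/
def IsTreePath (ω : ℕ → TreeVertex m) : Prop :=
  ∀ k, ω (k + 1) ∈ (ω k).successors

namespace IsTreePath

variable {ω : ℕ → TreeVertex m}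

theorem prefix_of_le (hω : IsTreePath ω) {i j : ℕ} (hij : i ≤ j) : ω i <+: ω j := by
  induction j, hij using Nat.le_induction with
  | base => exact List.prefix_rfl
  | succ j _ ih =>
    obtain ⟨a, ha⟩ := hω j
    exact ih.trans (ha ▸ List.prefix_append _ _)

theorem length_eq (hω : IsTreePath ω) (k : ℕ) : (ω k).length = (ω 0).length + k := by
  induction k with
  | zero => rfl
  | succ k ih =>
    obtain ⟨a, ha⟩ := hω k
    rw [← ha]
    simp [TreeVertex.child, ih, add_assoc]

/-- The positions form a chain of prefixes, so any position long enough to contain digit j gives the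
same value. The shift appears because a path may start below the root. -/
theorem vertex_branchOfPlay (hω : IsTreePath ω) (hm : 0 < m) (k : ℕ) :
    (branchOfPlay hm ω).vertex ((ω 0).length + k) = ω k := by
  have hl := hω.length_eq
  refine List.ext_getElem (by rw [TreeBranch.length_vertex, hl k]) fun j hj hj' => ?_
  have hj1 : j < (ω (j + 1)).length := by rw [hl]; omega
  have hget : (ω (j + 1)).getD j ⟨0, hm⟩ = (ω k).getD j ⟨0, hm⟩ := by
    rcases le_total k (j + 1) with h | h
    · exact TreeVertex.toBranch_eq_of_prefix hm (hω.prefix_of_le h) hj'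
    · exact (TreeVertex.toBranch_eq_of_prefix hm (hω.prefix_of_le h) hj1).symm
  simp only [TreeBranch.vertex, List.getElem_ofFn, branchOfPlay]
  rw [hget, List.getD_eq_getElem _ _ hj']

theorem tendsto (hω : IsTreePath ω) (hm : 0 < m) {α β : ℝ} {F : unitInterval → ℝ}
    {u : TreeVertex m → ℝ} (hu : IsDirichletSolution α β F u) :
    Tendsto (fun k => u (ω k)) atTop (𝓝 (F (branchOfPlay hm ω).point)) := by
  have := (hu.2 (branchOfPlay hm ω)).comp (tendsto_atTop_mono
    (fun k => Nat.le_add_left k (ω 0).length) tendsto_id)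
  refine this.congr fun k => ?_
  simp only [Function.comp_apply, hω.vertex_branchOfPlay]

end IsTreePath

end Branches

/-! ### Existence and uniqueness for the Dirichlet problem. -/

section Dirichlet

variable {m : ℕ} {α β : ℝ} {F : unitInterval → ℝ}

theorem IsPHarmonious.eq {u : TreeVertex m → ℝ} (hu : IsPHarmonious α β u) (x : TreeVertex m) :
    gameAverage α β u x = u x :=
  le_antisymm (hu.2 x) (hu.1 x)

theorem exists_child_sub_le (hp : IsGameParameters m α β) {u v : TreeVertex m → ℝ}
    (hu : IsPSubharmonious α β u) (hv : IsPSuperharmonious α β v) (x : TreeVertex m) :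
    ∃ a, u x - v x ≤ u (x.child a) - v (x.child a) := by
  have : Nonempty (Fin m) := ⟨⟨0, hp.pos⟩⟩
  obtain ⟨a, ha⟩ := Finite.exists_max fun a => u (x.child a) - v (x.child a)
  refine ⟨a, ?_⟩
  -- Taking for ε the largest difference over the children bounds the difference at x by it.
  have := gameAverage_le_add hp (f := u) (g := v) (x := x) (ε := u (x.child a) - v (x.child a))
    fun b => by linarith [ha b]
  linarith [hu x, hv x]

theorem IsDirichletSolution.le (hp : IsGameParameters m α β) {u v : TreeVertex m → ℝ}
    (hu : IsDirichletSolution α β F u) (hv : IsDirichletSolution α β F v) (x : TreeVertex m) :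
    u x ≤ v x := by
  choose a ha using exists_child_sub_le hp hu.1.1 hv.1.2
  let ω : ℕ → TreeVertex m := fun k => (fun y => y.child (a y))^[k] x
  have hsucc : ∀ k, ω (k + 1) = (ω k).child (a (ω k)) := fun k =>
    Function.iterate_succ_apply' _ _ _
  have hω : IsTreePath ω := fun k => ⟨_, (hsucc k).symm⟩
  have hmono : Monotone fun k => u (ω k) - v (ω k) :=
    monotone_nat_of_le_succ fun k => by rw [hsucc]; exact ha _
  have hlim := (hω.tendsto hp.pos hu).sub (hω.tendsto hp.pos hv)
  rw [sub_self] at hlim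
  exact sub_nonpos.1 (hmono.ge_of_tendsto hlim 0)

/-- Pointwise convergence suffices because the operator at x involves only finitely many children.
-/
theorem isPHarmonious_of_tendsto_iterate (hp : IsGameParameters m α β) {f u : TreeVertex m → ℝ}
    (h : ∀ x, Tendsto (fun k => (gameAverage α β)^[k] f x) atTop (𝓝 (u x))) :
    IsPHarmonious α β u := by
  suffices H : ∀ x, u x = gameAverage α β u x from ⟨fun x => (H x).le, fun x => (H x).ge⟩
  intro x
  refine tendsto_nhds_unique ((h x).comp (tendsto_add_atTop_nat 1)) ?_
  rw [Metric.tendsto_nhds]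
  intro ε hε
  have hev : ∀ᶠ k in atTop, ∀ a, |(gameAverage α β)^[k] f (x.child a) - u (x.child a)| < ε / 2 :=
    eventually_all.2 fun a => Metric.tendsto_nhds.1 (h (x.child a)) _ (half_pos hε)
  filter_upwards [hev] with k hk
  rw [Function.comp_apply, Function.iterate_succ_apply', Real.dist_eq]
  exact (abs_gameAverage_sub_le hp fun a => (hk a).le).trans_lt (half_lt_self hε)

theorem exists_forall_abs_le (hF : Continuous F) : ∃ C, ∀ t, |F t| ≤ C := by
  obtain ⟨C, hC⟩ := isCompact_univ.exists_bound_of_continuousOn hF.continuousOn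
  exact ⟨C, fun t => hC t (Set.mem_univ t)⟩

theorem exists_isDirichletSolution (hp : IsGameParameters m α β) (hF : Continuous F) :
    ∃ u : TreeVertex m → ℝ, IsBoundedFunction u ∧ IsDirichletSolution α β F u := by
  let f : TreeVertex m → ℝ := fun x => F (x.toBranch hp.pos).point
  have hm1 : 1 < m := lt_trans one_lt_two hp.two_lt
  -- The level N does not depend on the number k of iterations.
  have hclose : ∀ ε > 0, ∃ N, (∀ (x : TreeVertex m) (k : ℕ), N ≤ x.length →
      |(gameAverage α β)^[k] f x - f x| ≤ ε) ∧
      ∀ (π : TreeBranch m) (k : ℕ), N ≤ k → |f (π.vertex k) - F π.point| ≤ ε := by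
    intro ε hε
    obtain ⟨N, hN⟩ := exists_forall_abs_sub_le_of_digits_eq hm1 hF hε
    refine ⟨N, fun x k hx => ?_, fun π k hk => ?_⟩
    · exact abs_iterate_gameAverage_sub_const_le hp k fun y hy => hN _ _ fun j hj =>
        TreeVertex.toBranch_eq_of_prefix _ hy (hj.trans_le hx)
    · exact hN _ _ fun j hj => TreeVertex.toBranch_vertex _ _ (hj.trans_le hk)
  have hcauchy : ∀ x, ∃ l, Tendsto (fun k => (gameAverage α β)^[k] f x) atTop (𝓝 l) := by
    intro x
    refine cauchySeq_tendsto_of_complete (Metric.cauchySeq_iff'.2 fun ε hε => ?_)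
    obtain ⟨N, hN, -⟩ := hclose (ε / 2) (half_pos hε)
    refine ⟨N, fun n hn => ?_⟩
    obtain ⟨j, rfl⟩ := Nat.exists_eq_add_of_le hn
    -- The outer N iterations reach level at least N, where j further iterations change f by at most
    -- ε / 2.
    rw [Function.iterate_add_apply, Real.dist_eq]
    refine (abs_iterate_gameAverage_sub_le hp N fun y _ hy => hN y j ?_).trans_lt
      (half_lt_self hε)
    omega
  choose u hu using hcauchy
  obtain ⟨C, hC⟩ := exists_forall_abs_le hF
  refine ⟨u, ⟨C, fun x => ?_⟩, isPHarmonious_of_tendsto_iterate hp hu, fun π => ?_⟩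
  · refine le_of_tendsto (hu x).abs (Eventually.of_forall fun k => ?_)
    simpa using abs_iterate_gameAverage_sub_const_le hp (f := f) (c := 0) (ε := C) k (x := x)
      fun y _ => by simpa using hC _
  · rw [Metric.tendsto_atTop]
    intro ε hε
    obtain ⟨N, hN, hN'⟩ := hclose (ε / 3) (by positivity)
    refine ⟨N, fun k hk => ?_⟩
    have h1 : |u (π.vertex k) - f (π.vertex k)| ≤ ε / 3 :=
      le_of_tendsto ((hu _).sub_const _).abs (Eventually.of_forall fun j =>
        hN _ j (by rwa [TreeBranch.length_vertex]))
    have h2 := hN' π k hk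
    rw [Real.dist_eq]
    have := abs_sub_le (u (π.vertex k)) (f (π.vertex k)) (F π.point)
    linarith

end Dirichlet

/-! ### The law of the play and the value of the game. -/

section Play

variable {m : ℕ} {α β : ℝ} {F : unitInterval → ℝ}

theorem TreeVertex.coe_image_child (x : TreeVertex m) :
    ((Finset.univ.image x.child : Finset (TreeVertex m)) : Set (TreeVertex m)) = x.successors := by
  simp [TreeVertex.successors]

theorem TreeVertex.child_injective (x : TreeVertex m) : Function.Injective x.child :=
  fun a b h => by simpa [TreeVertex.child] using h

theorem integral_stepKernel (hp : IsGameParameters m α β) (S T : GameStrategy m) (k : ℕ)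
    (h : GameHistory m k) (u : TreeVertex m → ℝ) :
    ∫ y, u y ∂(stepKernel α β S T k h) =
      α / 2 * (u (S.move k h) + u (T.move k h)) + β / m * ∑ a, u (h.last.child a) := by
  have hα := hp.alpha_pos
  have hβ := hp.beta_pos
  have hint : Integrable u (Measure.count.restrict h.last.successors) := by
    change IntegrableOn u _ _
    rw [TreeVertex.successors, ← Set.iUnion_singleton_eq_range, integrableOn_finite_iUnion]
    simp
  change ∫ y, u y ∂(ENNReal.ofReal (α / 2) • Measure.dirac (S.move k h)
    + ENNReal.ofReal (α / 2) • Measure.dirac (T.move k h)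
    + ENNReal.ofReal (β / m) • Measure.count.restrict h.last.successors) = _
  have hd : ∀ y, Integrable u (ENNReal.ofReal (α / 2) • Measure.dirac y) := fun y =>
    (integrable_dirac (by simp)).smul_measure ENNReal.ofReal_ne_top
  rw [integral_add_measure ((hd _).add_measure (hd _)) (hint.smul_measure ENNReal.ofReal_ne_top),
    integral_add_measure (hd _) (hd _), integral_smul_measure, integral_smul_measure,
    integral_smul_measure, integral_dirac, integral_dirac, ← TreeVertex.coe_image_child,
    setIntegral_finset _ (by rw [TreeVertex.coe_image_child]; exact hint),
    Finset.sum_image h.last.child_injective.injOn,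
    ENNReal.toReal_ofReal (by positivity), ENNReal.toReal_ofReal (by positivity)]
  simp [Measure.real]
  ring

theorem ae_stepKernel_mem_successors (S T : GameStrategy m) (k : ℕ) (h : GameHistory m k) :
    ∀ᵐ y ∂(stepKernel α β S T k h), y ∈ h.last.successors := by
  change ∀ᵐ y ∂(ENNReal.ofReal (α / 2) • Measure.dirac (S.move k h)
    + ENNReal.ofReal (α / 2) • Measure.dirac (T.move k h)
    + ENNReal.ofReal (β / m) • Measure.count.restrict h.last.successors), _
  simp only [ae_add_measure_iff]
  refine ⟨⟨Measure.ae_smul_measure ?_ _, Measure.ae_smul_measure ?_ _⟩,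
    Measure.ae_smul_measure ?_ _⟩
  · simpa [ae_dirac_eq] using S.move_mem k h
  · simpa [ae_dirac_eq] using T.move_mem k h
  · exact ae_restrict_mem MeasurableSet.of_discrete

instance isProbabilityMeasure_playMeasure (hp : IsGameParameters m α β) (S T : GameStrategy m)
    (x₀ : TreeVertex m) : IsProbabilityMeasure (playMeasure hp S T x₀) := by
  have := isMarkovKernel_stepKernel hp S T
  unfold playMeasure
  infer_instance

/-- The defining property of the Ionescu-Tulcea measure, used for all one-step computations. -/
theorem playMeasure_map_step (hp : IsGameParameters m α β) (S T : GameStrategy m)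
    (x₀ : TreeVertex m) (k : ℕ) :
    (playMeasure hp S T x₀).map (fun ω => (Preorder.frestrictLe k ω, ω (k + 1))) =
      ((playMeasure hp S T x₀).map (Preorder.frestrictLe k)) ⊗ₘ stepKernel α β S T k := by
  have := isMarkovKernel_stepKernel hp S T
  unfold playMeasure
  rw [Kernel.traj_map_frestrictLe_apply]
  exact (Kernel.partialTraj_compProd_eq_map_traj (X := fun _ => TreeVertex m) (Nat.zero_le k)).symm

theorem ae_playMeasure_zero (hp : IsGameParameters m α β) (S T : GameStrategy m)
    (x₀ : TreeVertex m) : ∀ᵐ ω ∂(playMeasure hp S T x₀), ω 0 = x₀ := by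
  have := isMarkovKernel_stepKernel hp S T
  have h : (playMeasure hp S T x₀).map (Preorder.frestrictLe 0) =
      Measure.dirac (fun _ => x₀) := by
    unfold playMeasure
    rw [Kernel.traj_map_frestrictLe_apply, Kernel.partialTraj_self, Kernel.id_apply]
  have h2 : ∀ᵐ y ∂((playMeasure hp S T x₀).map (Preorder.frestrictLe 0)),
      GameHistory.last (k := 0) y = x₀ := by
    rw [h, ae_dirac_eq]
    rfl
  exact ae_of_ae_map (Preorder.measurable_frestrictLe 0).aemeasurable h2

theorem ae_playMeasure_isTreePath (hp : IsGameParameters m α β) (S T : GameStrategy m)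
    (x₀ : TreeVertex m) : ∀ᵐ ω ∂(playMeasure hp S T x₀), IsTreePath ω := by
  have := isMarkovKernel_stepKernel hp S T
  refine ae_all_iff.2 fun k => ?_
  have h : ∀ᵐ z ∂((playMeasure hp S T x₀).map
      (fun ω => (Preorder.frestrictLe (π := fun _ => TreeVertex m) k ω, ω (k + 1)))),
      z.2 ∈ (GameHistory.last (k := k) z.1).successors := by
    rw [playMeasure_map_step]
    refine Measure.ae_compProd_of_ae_ae MeasurableSet.of_discrete ?_
    exact Eventually.of_forall fun y => ae_stepKernel_mem_successors S T k y
  exact ae_of_ae_map (f := fun ω : ℕ → TreeVertex m =>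
    (Preorder.frestrictLe (π := fun _ => TreeVertex m) k ω, ω (k + 1))) (by fun_prop) h

theorem integrable_of_forall_abs_le {Ω : Type*} [MeasurableSpace Ω] {μ : Measure Ω}
    [IsFiniteMeasure μ] {f : Ω → ℝ} (hf : Measurable f) {C : ℝ} (hC : ∀ x, |f x| ≤ C) :
    Integrable f μ :=
  Integrable.of_bound hf.aestronglyMeasurable C (Eventually.of_forall hC)

/-- The submartingale property, needed only at the level of expectations: condition on the history
up to time k. -/
theorem integral_playMeasure_mono (hp : IsGameParameters m α β) {S T : GameStrategy m}
    {u : TreeVertex m → ℝ} (hb : IsBoundedFunction u)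
    (h : ∀ k y, u (GameHistory.last y) ≤ ∫ z, u z ∂(stepKernel α β S T k y))
    (x₀ : TreeVertex m) : Monotone fun k => ∫ ω, u (ω k) ∂(playMeasure hp S T x₀) := by
  have := isMarkovKernel_stepKernel hp S T
  obtain ⟨C, hC⟩ := hb
  refine monotone_nat_of_le_succ fun k => ?_
  have hmeas : Measurable (fun ω : ℕ → TreeVertex m =>
    (Preorder.frestrictLe (π := fun _ => TreeVertex m) k ω, ω (k + 1))) := by fun_prop
  have h0 : ∫ ω, u (ω k) ∂(playMeasure hp S T x₀) =
      ∫ y, u (GameHistory.last (k := k) y)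
        ∂((playMeasure hp S T x₀).map (Preorder.frestrictLe k)) := by
    rw [integral_map (Preorder.measurable_frestrictLe k).aemeasurable
      Measurable.of_discrete.aestronglyMeasurable]
    rfl
  have := Measure.isProbabilityMeasure_map (μ := playMeasure hp S T x₀)
    (Preorder.measurable_frestrictLe (X := fun _ => TreeVertex m) k).aemeasurable
  have h1 : ∫ ω, u (ω (k + 1)) ∂(playMeasure hp S T x₀) =
      ∫ y, ∫ z, u z ∂(stepKernel α β S T k y)
        ∂((playMeasure hp S T x₀).map (Preorder.frestrictLe k)) := by
    rw [← Measure.integral_compProd (f := fun z : GameHistory m k × TreeVertex m => u z.2)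
      (integrable_of_forall_abs_le Measurable.of_discrete fun z => hC _),
      ← playMeasure_map_step, integral_map hmeas.aemeasurable
      Measurable.of_discrete.aestronglyMeasurable]
  simp only [h0, h1]
  refine integral_mono (integrable_of_forall_abs_le Measurable.of_discrete fun z => hC _)
    (integrable_of_forall_abs_le Measurable.of_discrete (C := C) fun y => ?_) fun y => h k y
  simpa using norm_integral_le_of_norm_le_const (μ := stepKernel α β S T k y) (f := u)
    (Eventually.of_forall hC)

theorem measurable_branchOfPlay_point (hm : 0 < m) :
    Measurable fun ω : ℕ → TreeVertex m => (branchOfPlay hm ω).point := by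
  -- With this the product σ-algebra on branches is the Borel one, so continuity of `point` gives
  -- measurability.
  have : BorelSpace (Fin m) := ⟨borel_eq_top_of_discrete.symm⟩
  refine TreeBranch.continuous_point.measurable.comp (measurable_pi_lambda _ fun j => ?_)
  exact (Measurable.of_discrete (f := fun x : TreeVertex m => x.getD j ⟨0, hm⟩)).comp
    (measurable_pi_apply (j + 1))

theorem expectedPayoff_eq (hp : IsGameParameters m α β) (hF : Continuous F)
    (S T : GameStrategy m) (x₀ : TreeVertex m) :
    expectedPayoff hp F S T x₀ =
      ∫ ω, F (branchOfPlay hp.pos ω).point ∂(playMeasure hp S T x₀) :=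
  integral_map (measurable_branchOfPlay_point _).aemeasurable
    hF.measurable.aestronglyMeasurable

theorem abs_expectedPayoff_le (hp : IsGameParameters m α β) (hF : Continuous F) {C : ℝ}
    (hC : ∀ t, |F t| ≤ C) (S T : GameStrategy m) (x₀ : TreeVertex m) :
    |expectedPayoff hp F S T x₀| ≤ C := by
  rw [expectedPayoff_eq hp hF]
  simpa using norm_integral_le_of_norm_le_const (μ := playMeasure hp S T x₀)
    (f := fun ω => F (branchOfPlay hp.pos ω).point) (Eventually.of_forall fun ω => hC _)

/-- Dominated convergence: almost every play is a tree path, along which u tends to the payoff. -/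
theorem tendsto_integral_playMeasure (hp : IsGameParameters m α β) (hF : Continuous F)
    {u : TreeVertex m → ℝ} (hb : IsBoundedFunction u) (hu : IsDirichletSolution α β F u)
    (S T : GameStrategy m) (x₀ : TreeVertex m) :
    Tendsto (fun k => ∫ ω, u (ω k) ∂(playMeasure hp S T x₀)) atTop
      (𝓝 (expectedPayoff hp F S T x₀)) := by
  obtain ⟨C, hC⟩ := hb
  rw [expectedPayoff_eq hp hF]
  refine tendsto_integral_of_dominated_convergence (fun _ => C) (fun k => ?_)
    (integrable_const _) (fun k => Eventually.of_forall fun ω => hC _) ?_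
  · exact ((Measurable.of_discrete (f := u)).comp (measurable_pi_apply k)).aestronglyMeasurable
  · filter_upwards [ae_playMeasure_isTreePath hp S T x₀] with ω hω using hω.tendsto hp.pos hu

theorem le_expectedPayoff (hp : IsGameParameters m α β) (hF : Continuous F)
    {u : TreeVertex m → ℝ} (hb : IsBoundedFunction u) (hu : IsDirichletSolution α β F u)
    {S T : GameStrategy m}
    (h : ∀ k y, u (GameHistory.last y) ≤ ∫ z, u z ∂(stepKernel α β S T k y))
    (x₀ : TreeVertex m) : u x₀ ≤ expectedPayoff hp F S T x₀ := by
  have h0 : ∫ ω, u (ω 0) ∂(playMeasure hp S T x₀) = u x₀ := by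
    rw [integral_congr_ae (g := fun _ => u x₀)]
    · simp
    · filter_upwards [ae_playMeasure_zero hp S T x₀] with ω hω
      rw [hω]
  rw [← h0]
  exact (integral_playMeasure_mono hp hb h x₀).ge_of_tendsto
    (tendsto_integral_playMeasure hp hF hb hu S T x₀) 0

theorem IsDirichletSolution.neg {u : TreeVertex m → ℝ} (hu : IsDirichletSolution α β F u) :
    IsDirichletSolution α β (fun t => -F t) fun x => -u x := by
  refine ⟨⟨fun x => ?_, fun x => ?_⟩, fun π => (hu.2 π).neg⟩ <;>
  · rw [gameAverage_neg, hu.1.eq]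

theorem expectedPayoff_neg (hp : IsGameParameters m α β) (S T : GameStrategy m)
    (x₀ : TreeVertex m) :
    expectedPayoff hp (fun t => -F t) S T x₀ = -expectedPayoff hp F S T x₀ :=
  integral_neg _

theorem expectedPayoff_le (hp : IsGameParameters m α β) (hF : Continuous F)
    {u : TreeVertex m → ℝ} (hb : IsBoundedFunction u) (hu : IsDirichletSolution α β F u)
    {S T : GameStrategy m}
    (h : ∀ k y, ∫ z, u z ∂(stepKernel α β S T k y) ≤ u (GameHistory.last y))
    (x₀ : TreeVertex m) : expectedPayoff hp F S T x₀ ≤ u x₀ := by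
  -- Negating F and u turns the lower bound into the upper one.
  have := le_expectedPayoff hp (F := fun t => -F t) hF.neg (u := fun x => -u x) (S := S) (T := T)
    (by simpa [IsBoundedFunction] using hb) hu.neg
    (fun k y => by rw [integral_neg]; exact neg_le_neg (h k y)) x₀
  rw [expectedPayoff_neg] at this
  exact neg_le_neg_iff.1 this

/-- The strategy that moves to the successor with the digit `a x`, when the position is `x`. -/
def GameStrategy.ofDigit (a : TreeVertex m → Fin m) : GameStrategy m where
  move _ h := h.last.child (a h.last)
  move_mem _ _ := ⟨_, rfl⟩

theorem exists_forall_le_expectedPayoff (hp : IsGameParameters m α β) (hF : Continuous F)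
    {u : TreeVertex m → ℝ} (hb : IsBoundedFunction u) (hu : IsDirichletSolution α β F u) :
    ∃ S : GameStrategy m, ∀ (T : GameStrategy m) (x₀ : TreeVertex m),
      u x₀ ≤ expectedPayoff hp F S T x₀ := by
  have : Nonempty (Fin m) := ⟨⟨0, hp.pos⟩⟩
  have hα := hp.alpha_pos
  choose a ha using fun x : TreeVertex m => Finite.exists_max fun a => u (x.child a)
  refine ⟨.ofDigit a, fun T => le_expectedPayoff hp hF hb hu fun k y => ?_⟩
  obtain ⟨b, hTb⟩ := T.move_mem k y
  have hsup : (⨆ c : Fin m, u (y.last.child c)) ≤ u (y.last.child (a y.last)) :=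
    ciSup_le (ha y.last)
  have hinf : (⨅ c : Fin m, u (y.last.child c)) ≤ u (T.move k y) := by
    rw [← hTb]
    exact ciInf_le (f := fun c => u (y.last.child c)) (Set.finite_range _).bddBelow b
  rw [integral_stepKernel hp, ← hu.1.eq y.last, gameAverage]
  gcongr
  exact hsup

theorem exists_forall_expectedPayoff_le (hp : IsGameParameters m α β) (hF : Continuous F)
    {u : TreeVertex m → ℝ} (hb : IsBoundedFunction u) (hu : IsDirichletSolution α β F u) :
    ∃ T : GameStrategy m, ∀ (S : GameStrategy m) (x₀ : TreeVertex m),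
      expectedPayoff hp F S T x₀ ≤ u x₀ := by
  have : Nonempty (Fin m) := ⟨⟨0, hp.pos⟩⟩
  have hα := hp.alpha_pos
  choose a ha using fun x : TreeVertex m => Finite.exists_min fun a => u (x.child a)
  refine ⟨.ofDigit a, fun S => expectedPayoff_le hp hF hb hu fun k y => ?_⟩
  obtain ⟨b, hSb⟩ := S.move_mem k y
  have hinf : u (y.last.child (a y.last)) ≤ ⨅ c : Fin m, u (y.last.child c) :=
    le_ciInf (ha y.last)
  have hsup : u (S.move k y) ≤ ⨆ c : Fin m, u (y.last.child c) := by
    rw [← hSb]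
    exact le_ciSup (f := fun c => u (y.last.child c)) (Set.finite_range _).bddAbove b
  rw [integral_stepKernel hp, ← hu.1.eq y.last, gameAverage]
  gcongr
  exact hinf

/-- The optimal strategies form a saddle point. The bound on F makes the real suprema and infima
genuine rather than default values. -/
theorem value_eq (hp : IsGameParameters m α β) (hF : Continuous F)
    {u : TreeVertex m → ℝ} (hb : IsBoundedFunction u) (hu : IsDirichletSolution α β F u)
    (x₀ : TreeVertex m) : valueI hp F x₀ = u x₀ ∧ valueII hp F x₀ = u x₀ := by
  obtain ⟨C, hC⟩ := exists_forall_abs_le hF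
  have hE := fun S T => abs_le.1 (abs_expectedPayoff_le hp hF hC S T x₀)
  obtain ⟨S₀, hS₀⟩ := exists_forall_le_expectedPayoff hp hF hb hu
  obtain ⟨T₀, hT₀⟩ := exists_forall_expectedPayoff_le hp hF hb hu
  have : Nonempty (GameStrategy m) := ⟨S₀⟩
  have hI : ∀ S, ⨅ T, expectedPayoff hp F S T x₀ ≤ u x₀ := fun S =>
    (ciInf_le ⟨-C, by rintro _ ⟨T, rfl⟩; exact (hE S T).1⟩ T₀).trans (hT₀ S x₀)
  have hII : ∀ T, u x₀ ≤ ⨆ S, expectedPayoff hp F S T x₀ := fun T =>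
    (hS₀ T x₀).trans
      (le_ciSup (f := fun S => expectedPayoff hp F S T x₀)
        ⟨C, by rintro _ ⟨S, rfl⟩; exact (hE S T).2⟩ S₀)
  refine ⟨le_antisymm (ciSup_le hI) ?_, le_antisymm ?_ (le_ciInf hII)⟩
  · exact (le_ciInf fun T => hS₀ T x₀).trans
      (le_ciSup (f := fun S => ⨅ T, expectedPayoff hp F S T x₀)
        ⟨u x₀, by rintro _ ⟨S, rfl⟩; exact hI S⟩ S₀)
  · exact (ciInf_le (f := fun T => ⨆ S, expectedPayoff hp F S T x₀)
      ⟨u x₀, by rintro _ ⟨T, rfl⟩; exact hII T⟩ T₀).trans (ciSup_le fun S => hT₀ S x₀)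

end Play

theorem mainTheorem4 {m : ℕ} {α β : ℝ} (hp : IsGameParameters m α β)
    (F : unitInterval → ℝ) (hF : Continuous F) :
    (∃! u : TreeVertex m → ℝ, IsBoundedFunction u ∧ IsDirichletSolution α β F u) ∧
    ∀ u : TreeVertex m → ℝ, IsBoundedFunction u ∧ IsDirichletSolution α β F u →
      ∀ x₀ : TreeVertex m, valueI hp F x₀ = u x₀ ∧ valueII hp F x₀ = u x₀ := by
  refine ⟨?_, fun u hu => value_eq hp hF hu.1 hu.2⟩
  obtain ⟨u, hb, hu⟩ := exists_isDirichletSolution hp hF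
  exact ⟨u, ⟨hb, hu⟩, fun v hv => funext fun x =>
    le_antisymm (hv.2.le hp hu x) (hu.le hp hv.2 x)⟩
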